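/- Let $k$ be a field and let $A=\bigoplus_{n\ge 0}A(n)$ be a graded Hopf algebra over $k$ with bijective antipode. Let $M$ be a graded (left-left) Yetter-Drinfel'd module over $A$, that is, a Yetter-Drinfel'd module with a vector space grading $M=\bigoplus_{n\ge 1}M(n)$ such that the action $A\otimes M\to M$ and the coaction $M\to A\otimes M$ are graded maps, where $(A\otimes M)(n)=\sum_{i+j=n}A(i)\otimes M(j)$. Let $\mathfrak{B}(M)$ be the Nichols algebra of $M$: a braided Hopf algebra in ${}^A_A\mathcal{YD}$ which has a grading $\mathfrak{B}(M)=\bigoplus_{n\ge0}R(n)$ as an algebra and as a coalgebra such that $c(R(i)\otimes R(j))\subset R(j)\otimes R(i)$ for the braiding $c(x\otimes y)=x_{(-1)}y\otimes x_{(0)}$, such that $R(1)\cong M$ as Yetter-Drinfel'd modules (in particular as braided vector spaces), $\mathfrak{B}(M)$ is generated by $R(1)$ as an algebra, and $R(1)$ is the space of primitive elements $\{x:\Delta(x)=x\otimes 1+1\otimes x\}$. Identify $M$ with $R(1)\subset\mathfrak{B}(M)$. Then there is a grading \[ \mathfrak{B}(M)=\bigoplus_{n\ge 0}\mathfrak{B}(M)[n]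 \] for which the action and the coaction of $A$ on $\mathfrak{B}(M)$ are graded maps (so that $\mathfrak{B}(M)$ is a graded Yetter-Drinfel'd module over $A$, with degrees $n\ge 0$) and for which $\mathfrak{B}(M)$ is a graded braided Hopf algebra (multiplication, unit, comultiplication, counit and antipode are graded maps), such that \[ \mathfrak{B}(M)[0]=k1 \quad\text{and}\quad \mathfrak{B}(M)[1]=M(1). \] -/

import Mathlib

open scoped TensorProduct

namespace Nichols

noncomputable section

/-! ### Yetter-Drinfeld modules -/

section YetterDrinfeld

variable (k A M : Type*) [Field k] [Ring A] [HopfAlgebra k A]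
  [AddCommGroup M] [Module k M] [Module A M] [IsScalarTower k A M]

/-- The action of an algebra on a module as a linear map `a ⊗ m ↦ a • m`. -/
def act : A ⊗[k] M →ₗ[k] M :=
  TensorProduct.lift (Algebra.lsmul k k M : A →ₐ[k] Module.End k M).toLinearMap

@[simp] theorem act_tmul (a : A) (m : M) : act k A M (a ⊗ₜ m) = a • m := rfl

/-- The linear map `a ⊗ (b ⊗ c) ↦ (x ⊗ m ↦ a x S(c) ⊗ b m)`. -/
def ydTwist : A ⊗[k] (A ⊗[k] A) →ₗ[k] (A ⊗[k] M →ₗ[k] A ⊗[k] M) :=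
  TensorProduct.homTensorHomMap (RingHom.id k) A M A M ∘ₗ
    (TensorProduct.comm k (Module.End k M) (Module.End k A)).toLinearMap ∘ₗ
    TensorProduct.map (Algebra.lsmul k k M : A →ₐ[k] Module.End k M).toLinearMap
      (TensorProduct.lift
        ((LinearMap.mul k (Module.End k A)).compl₁₂ (LinearMap.mul k A)
          ((LinearMap.mul k A).flip ∘ₗ HopfAlgebra.antipode k))) ∘ₗ
    (TensorProduct.leftComm k A A A).toLinearMap

@[simp] theorem ydTwist_tmul (a b c x : A) (m : M) :
    ydTwist k A M (a ⊗ₜ (b ⊗ₜ c)) (x ⊗ₜ m) =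
      (a * (x * HopfAlgebra.antipode k c)) ⊗ₜ (b • m) := rfl

end YetterDrinfeld

/-- A left-left Yetter-Drinfeld module over the Hopf algebra `A`: a left `A`-module with a left
`A`-coaction `δ` (written `δ m = m₍₋₁₎ ⊗ m₍₀₎`) such that
`δ (a m) = a₍₁₎ m₍₋₁₎ S(a₍₃₎) ⊗ a₍₂₎ m₍₀₎`. -/
class YetterDrinfeldModule (k A M : Type*) [Field k] [Ring A] [HopfAlgebra k A]
    [AddCommGroup M] [Module k M] [Module A M] [IsScalarTower k A M] where
  /-- The coaction. -/
  coact : M →ₗ[k] A ⊗[k] M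
  coact_coassoc :
    (TensorProduct.assoc k A A M).toLinearMap ∘ₗ
        (Coalgebra.comul (R := k) (A := A)).rTensor M ∘ₗ coact =
      coact.lTensor A ∘ₗ coact
  coact_counit :
    (TensorProduct.lid k M).toLinearMap ∘ₗ
        (Coalgebra.counit (R := k) (A := A)).rTensor M ∘ₗ coact =
      LinearMap.id
  coact_smul : ∀ (a : A) (m : M),
    coact (a • m) =
      ydTwist k A M ((Coalgebra.comul (R := k) (A := A)).lTensor A (Coalgebra.comul a)) (coact m)


open YetterDrinfeldModule (coact)

section Tensor

variable (k A M N : Type*) [Field k] [Ring A] [HopfAlgebra k A]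
  [AddCommGroup M] [Module k M] [Module A M] [IsScalarTower k A M]
  [AddCommGroup N] [Module k N] [Module A N] [IsScalarTower k A N]

/-- The diagonal action of `A` on `M ⊗ N`: `a (m ⊗ n) = a₍₁₎ m ⊗ a₍₂₎ n`. -/
def tensorAct : A →ₗ[k] (M ⊗[k] N →ₗ[k] M ⊗[k] N) :=
  TensorProduct.homTensorHomMap (RingHom.id k) M N M N ∘ₗ
    TensorProduct.map (Algebra.lsmul k k M : A →ₐ[k] Module.End k M).toLinearMap
      (Algebra.lsmul k k N : A →ₐ[k] Module.End k N).toLinearMap ∘ₗ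
    Coalgebra.comul

variable [YetterDrinfeldModule k A M]

/-- The braiding `M ⊗ N → N ⊗ M`, `m ⊗ n ↦ m₍₋₁₎ n ⊗ m₍₀₎`. -/
def braiding : M ⊗[k] N →ₗ[k] N ⊗[k] M :=
  (act k A N).rTensor M ∘ₗ (TensorProduct.rightComm k A M N).toLinearMap ∘ₗ
    (coact (k := k) (A := A) (M := M)).rTensor N

variable [YetterDrinfeldModule k A N]

/-- The codiagonal coaction on `M ⊗ N`: `m ⊗ n ↦ m₍₋₁₎ n₍₋₁₎ ⊗ (m₍₀₎ ⊗ n₍₀₎)`. -/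
def tensorCoact : M ⊗[k] N →ₗ[k] A ⊗[k] (M ⊗[k] N) :=
  (LinearMap.mul' k A).rTensor (M ⊗[k] N) ∘ₗ
    (TensorProduct.tensorTensorTensorComm k A M A N).toLinearMap ∘ₗ
    TensorProduct.map coact coact

end Tensor

/-! ### Braided Hopf algebras -/

/-- The multiplication `(m ⊗ m) (id ⊗ c ⊗ id)` of the braided tensor product `R ⊗ R`, where `m` is
the multiplication and `c` the braiding of `R`. -/
def braidedMul (k A R : Type*) [Field k] [Ring A] [HopfAlgebra k A] [Ring R] [Algebra k R]
    [Module A R] [IsScalarTower k A R] [YetterDrinfeldModule k A R] :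
    (R ⊗[k] R) ⊗[k] (R ⊗[k] R) →ₗ[k] R ⊗[k] R :=
  TensorProduct.map (LinearMap.mul' k R) (LinearMap.mul' k R) ∘ₗ
    (TensorProduct.assoc k R R (R ⊗[k] R)).symm.toLinearMap ∘ₗ
    ((TensorProduct.assoc k R R R).toLinearMap ∘ₗ
      (braiding k A R R).rTensor R ∘ₗ
      (TensorProduct.assoc k R R R).symm.toLinearMap).lTensor R ∘ₗ
    (TensorProduct.assoc k R R (R ⊗[k] R)).toLinearMap

/-- A braided Hopf algebra in the category of Yetter-Drinfeld modules over `A`: an algebra and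
coalgebra `R` whose structure maps are `A`-linear and `A`-colinear, whose comultiplication
`R → R ⊗ R` (braided tensor product) and counit are algebra morphisms, and whose identity map is
convolution invertible. -/
class BraidedHopfAlgebra (k A R : Type*) [Field k] [Ring A] [HopfAlgebra k A]
    [Ring R] [Algebra k R] [Coalgebra k R] [Module A R] [IsScalarTower k A R]
    [YetterDrinfeldModule k A R] where
  smul_mul : ∀ (a : A) (x y : R),
    a • (x * y) = LinearMap.mul' k R (tensorAct k A R R a (x ⊗ₜ y))
  smul_one : ∀ a : A, a • (1 : R) = algebraMap k R (Coalgebra.counit a)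
  comul_smul : ∀ (a : A) (x : R),
    Coalgebra.comul (R := k) (a • x) = tensorAct k A R R a (Coalgebra.comul x)
  counit_smul : ∀ (a : A) (x : R),
    Coalgebra.counit (R := k) (a • x) = Coalgebra.counit (R := k) a * Coalgebra.counit (R := k) x
  coact_mul : ∀ x y : R,
    coact (k := k) (A := A) (x * y) =
      (LinearMap.mul' k R).lTensor A (tensorCoact k A R R (x ⊗ₜ y))
  coact_one : coact (k := k) (A := A) (1 : R) = 1 ⊗ₜ 1
  coact_comul : ∀ x : R,
    tensorCoact k A R R (Coalgebra.comul x) =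
      (Coalgebra.comul (R := k) (A := R)).lTensor A (coact x)
  coact_counit : ∀ x : R,
    (Coalgebra.counit (R := k) (A := R)).lTensor A (coact x) =
      (1 : A) ⊗ₜ[k] Coalgebra.counit (R := k) x
  comul_mul : ∀ x y : R,
    Coalgebra.comul (R := k) (x * y) =
      braidedMul k A R (Coalgebra.comul x ⊗ₜ Coalgebra.comul y)
  comul_one : Coalgebra.comul (R := k) (1 : R) = 1 ⊗ₜ 1
  counit_mul : ∀ x y : R,
    Coalgebra.counit (R := k) (x * y) = Coalgebra.counit (R := k) x * Coalgebra.counit (R := k) y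
  counit_one : Coalgebra.counit (R := k) (1 : R) = 1
  /-- The antipode, i.e. the convolution inverse of the identity. -/
  antipode : R →ₗ[k] R
  antipode_left :
    LinearMap.mul' k R ∘ₗ antipode.rTensor R ∘ₗ Coalgebra.comul =
      Algebra.linearMap k R ∘ₗ Coalgebra.counit
  antipode_right :
    LinearMap.mul' k R ∘ₗ antipode.lTensor R ∘ₗ Coalgebra.comul =
      Algebra.linearMap k R ∘ₗ Coalgebra.counit

/-! ### Gradings -/

/-- The image of `U ⊗ V` in `M ⊗ N`. -/
def tensorSub {k M N : Type*} [Field k] [AddCommGroup M] [Module k M] [AddCommGroup N] [Module k N]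
    (U : Submodule k M) (V : Submodule k N) : Submodule k (M ⊗[k] N) :=
  LinearMap.range (TensorProduct.mapIncl U V)

/-- The usual grading of a tensor product: `(M ⊗ N)(n) = ∑_{i + j = n} M(i) ⊗ N(j)`. -/
def tensorGrading {k M N : Type*} [Field k] [AddCommGroup M] [Module k M] [AddCommGroup N]
    [Module k N] (ℳ : ℕ → Submodule k M) (𝒩 : ℕ → Submodule k N) (n : ℕ) :
    Submodule k (M ⊗[k] N) :=
  ⨆ (i : ℕ) (j : ℕ) (_ : i + j = n), tensorSub (ℳ i) (𝒩 j)

/-- `R = ⨁ R(n)` is a grading of `R` both as an algebra and as a coalgebra. -/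
structure IsAlgCoalgGrading {k R : Type*} [Field k] [Ring R] [Algebra k R] [Coalgebra k R]
    (ℛ : ℕ → Submodule k R) : Prop where
  isInternal : DirectSum.IsInternal ℛ
  one_mem : (1 : R) ∈ ℛ 0
  mul_mem : ∀ {i j : ℕ} {x y : R}, x ∈ ℛ i → y ∈ ℛ j → x * y ∈ ℛ (i + j)
  comul_mem : ∀ {n : ℕ} {x : R}, x ∈ ℛ n → Coalgebra.comul (R := k) x ∈ tensorGrading ℛ ℛ n
  counit_eq_zero : ∀ {n : ℕ} {x : R}, n ≠ 0 → x ∈ ℛ n → Coalgebra.counit (R := k) x = 0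

/-- `A = ⨁ A(n)` is a graded Hopf algebra. -/
structure IsHopfGrading {k A : Type*} [Field k] [Ring A] [HopfAlgebra k A]
    (𝒜 : ℕ → Submodule k A) : Prop extends IsAlgCoalgGrading 𝒜 where
  antipode_mem : ∀ {n : ℕ} {a : A}, a ∈ 𝒜 n → HopfAlgebra.antipode k a ∈ 𝒜 n

/-- `M = ⨁ M(n)` is a vector space grading of the Yetter-Drinfeld module `M` over the graded Hopf
algebra `A` for which the action and the coaction are graded maps. -/
structure IsYDGrading {k A M : Type*} [Field k] [Ring A] [HopfAlgebra k A]
    [AddCommGroup M] [Module k M] [Module A M] [IsScalarTower k A M] [YetterDrinfeldModule k A M]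
    (𝒜 : ℕ → Submodule k A) (ℳ : ℕ → Submodule k M) : Prop where
  isInternal : DirectSum.IsInternal ℳ
  smul_mem : ∀ {i j : ℕ} {a : A} {m : M}, a ∈ 𝒜 i → m ∈ ℳ j → a • m ∈ ℳ (i + j)
  coact_mem : ∀ {n : ℕ} {m : M}, m ∈ ℳ n → coact (k := k) (A := A) m ∈ tensorGrading 𝒜 ℳ n

/-- `R = ⨁ R(n)` is a graded braided Hopf algebra. -/
structure IsBraidedHopfGrading {k : Type*} (A : Type*) {R : Type*} [Field k] [Ring A]
    [HopfAlgebra k A] [Ring R] [Algebra k R] [Coalgebra k R] [Module A R] [IsScalarTower k A R]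
    [YetterDrinfeldModule k A R] [BraidedHopfAlgebra k A R]
    (ℛ : ℕ → Submodule k R) : Prop extends IsAlgCoalgGrading ℛ where
  antipode_mem : ∀ {n : ℕ} {x : R}, x ∈ ℛ n →
    BraidedHopfAlgebra.antipode (k := k) (A := A) x ∈ ℛ n

/-! ### Nichols algebras -/

/-- The braided Hopf algebra `B`, together with the map `ι : M → B`, is a Nichols algebra of the
Yetter-Drinfeld module `M`: there is a grading `B = ⨁ R(n)` as an algebra and coalgebra,
compatible with the braiding, such that `ι` is an isomorphism of Yetter-Drinfeld modules from `M`
onto `R(1)`, the algebra `B` is generated by `R(1)`, and `R(1)` is the space of primitive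
elements. -/
structure IsNicholsAlgebra {k : Type*} (A : Type*) {M B : Type*} [Field k] [Ring A]
    [HopfAlgebra k A]
    [AddCommGroup M] [Module k M] [Module A M] [IsScalarTower k A M] [YetterDrinfeldModule k A M]
    [Ring B] [Algebra k B] [Coalgebra k B] [Module A B] [IsScalarTower k A B]
    [YetterDrinfeldModule k A B] [BraidedHopfAlgebra k A B] (ι : M →ₗ[k] B) : Prop where
  ι_injective : Function.Injective ι
  ι_smul : ∀ (a : A) (m : M), ι (a • m) = a • ι m
  ι_coact : ∀ m : M, coact (k := k) (A := A) (ι m) = ι.lTensor A (coact m)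
  exists_grading : ∃ ℛ : ℕ → Submodule k B,
    IsAlgCoalgGrading ℛ ∧
    (∀ i j : ℕ, (tensorSub (ℛ i) (ℛ j)).map (braiding k A B B) ≤ tensorSub (ℛ j) (ℛ i)) ∧
    LinearMap.range ι = ℛ 1 ∧
    Algebra.adjoin k (ℛ 1 : Set B) = ⊤ ∧
    ∀ x : B, x ∈ ℛ 1 ↔ Coalgebra.comul (R := k) x = x ⊗ₜ 1 + 1 ⊗ₜ x

end

end Nichols

/-! Give a product of homogeneous elements of `M` the sum of their degrees, and let `wordGrading ι ℳ
n` be the span of the products of degree `n`. These spaces span because `B` is generated by `M`.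
They are stable under all the structure maps: action, coaction and comultiplication are determined
on products by their values on `M`, where they are graded. The antipode follows because degree `0`
consists of scalars.

The real content is that the sum is direct (`iSupIndep_wordGrading_of_separation`). Words are also
homogeneous for the length grading `ℛ`, so it suffices to separate degrees after applying each
length projection `π m`, by strong induction on `m`. Length `0` is trivial and length `1` is the
grading of `M`. For `m ≥ 2` (`exists_separation_succ_succ`), an element of length `m` is determined
by the components of its comultiplication with both lengths positive, since an element without such
components is primitive, hence of length `1`. Those components involve only lengths below `m`, where
degrees are already separated. -/

namespace Nichols

noncomputable section

open YetterDrinfeldModule (coact)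

/-! ### Tensor gradings, independence and projections. -/

section Gradings

variable {k M N P : Type*} [Field k] [AddCommGroup M] [Module k M] [AddCommGroup N] [Module k N]
  [AddCommGroup P] [Module k P]

theorem tensorSub_le {U : Submodule k M} {V : Submodule k N} {W : Submodule k (M ⊗[k] N)}
    (h : ∀ x ∈ U, ∀ y ∈ V, x ⊗ₜ[k] y ∈ W) : tensorSub U V ≤ W := by
  rintro _ ⟨t, rfl⟩
  induction t with
  | zero => simp
  | tmul x y => exact h _ x.2 _ y.2
  | add s t hs ht => simpa using W.add_mem hs ht

theorem tmul_mem_tensorSub {U : Submodule k M} {V : Submodule k N} {x : M} {y : N}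
    (hx : x ∈ U) (hy : y ∈ V) : x ⊗ₜ[k] y ∈ tensorSub U V :=
  ⟨⟨x, hx⟩ ⊗ₜ ⟨y, hy⟩, rfl⟩

theorem tensorGrading_le {ℳ : ℕ → Submodule k M} {𝒩 : ℕ → Submodule k N} {n : ℕ}
    {W : Submodule k (M ⊗[k] N)}
    (h : ∀ i j, i + j = n → ∀ x ∈ ℳ i, ∀ y ∈ 𝒩 j, x ⊗ₜ[k] y ∈ W) :
    tensorGrading ℳ 𝒩 n ≤ W :=
  iSup_le fun i => iSup_le fun j => iSup_le fun hij => tensorSub_le (h i j hij)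

theorem tmul_mem_tensorGrading {ℳ : ℕ → Submodule k M} {𝒩 : ℕ → Submodule k N} {i j n : ℕ}
    (hn : i + j = n) {x : M} {y : N} (hx : x ∈ ℳ i) (hy : y ∈ 𝒩 j) :
    x ⊗ₜ[k] y ∈ tensorGrading ℳ 𝒩 n :=
  Submodule.mem_iSup_of_mem i <| Submodule.mem_iSup_of_mem j <|
    Submodule.mem_iSup_of_mem hn <| tmul_mem_tensorSub hx hy

/-- A linear map on `M ⊗ N` which maps homogeneous pure tensors of degree `n` into `W` maps
`(M ⊗ N)(n)` into `W`. -/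
theorem map_mem_of_mem_tensorGrading {ℳ : ℕ → Submodule k M} {𝒩 : ℕ → Submodule k N} {n : ℕ}
    {W : Submodule k P} (f : M ⊗[k] N →ₗ[k] P)
    (h : ∀ i j, i + j = n → ∀ x ∈ ℳ i, ∀ y ∈ 𝒩 j, f (x ⊗ₜ[k] y) ∈ W)
    {t : M ⊗[k] N} (ht : t ∈ tensorGrading ℳ 𝒩 n) : f t ∈ W :=
  tensorGrading_le (W := W.comap f) h ht

/-- A map that kills all the other summands but does not kill a nonzero `x ∈ U n` shows that `x` is
not in their span. The map may depend on `x` and need not be a true projection. -/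
theorem iSupIndep_of_forall_exists_projection {U : ℕ → Submodule k M}
    (h : ∀ n, ∀ x ∈ U n, ∃ f : M →ₗ[k] P, (∀ m, m ≠ n → ∀ y ∈ U m, f y = 0) ∧
      (f x = 0 → x = 0)) : iSupIndep U := by
  intro n
  rw [Submodule.disjoint_def]
  intro x hx hx'
  obtain ⟨f, hf, hfx⟩ := h n x hx
  refine hfx ?_
  have : (⨆ m, ⨆ (_ : m ≠ n), U m) ≤ LinearMap.ker f :=
    iSup_le fun m => iSup_le fun hm y hy => hf m hm y hy
  exact this hx'

/-- The `U i` need not span `M`: over a field the injection `⨁ U i → M` has a linear retraction,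
which extends the component maps to all of `M`. -/
theorem exists_projection_of_iSupIndep {U : ℕ → Submodule k M} (h : iSupIndep U) :
    ∃ p : ℕ → M →ₗ[k] M, ∀ i j, ∀ x ∈ U j, p i x = if i = j then x else 0 := by
  obtain ⟨g, hg⟩ := LinearMap.exists_leftInverse_of_injective (DirectSum.coeLinearMap U)
    (LinearMap.ker_eq_bot.2 h.dfinsupp_lsum_injective)
  refine ⟨fun i => (U i).subtype ∘ₗ DirectSum.component k ℕ (fun i => U i) i ∘ₗ g, ?_⟩
  intro i j x hx
  have : g x = DirectSum.lof k ℕ (fun i => U i) j ⟨x, hx⟩ := by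
    have := LinearMap.congr_fun hg (DirectSum.lof k ℕ (fun i => U i) j ⟨x, hx⟩)
    rwa [LinearMap.comp_apply, DirectSum.coeLinearMap_lof] at this
  simp only [LinearMap.comp_apply, this]
  split_ifs with hij
  · subst hij
    simp [DirectSum.component.lof_self]
  · rw [DirectSum.component.of, dif_neg (fun e => hij e.symm)]
    simp

/-- The projections of an internal grading onto its components. -/
theorem exists_projection_of_isInternal {U : ℕ → Submodule k M} (h : DirectSum.IsInternal U) :
    ∃ p : ℕ → M →ₗ[k] M, (∀ i j, ∀ x ∈ U j, p i x = if i = j then x else 0) ∧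
      (∀ i x, p i x ∈ U i) ∧ ∀ x, (∀ i, p i x = 0) → x = 0 := by
  obtain ⟨p, hp⟩ := exists_projection_of_iSupIndep h.submodule_iSupIndep
  have htop := h.submodule_iSup_eq_top
  refine ⟨p, hp, fun i => ?_, fun x hx => ?_⟩
  · have : (⨆ j, U j) ≤ (U i).comap (p i) := iSup_le fun j x hx => by
      rw [Submodule.mem_comap, hp i j x hx]
      split_ifs with hij
      · exact hij ▸ hx
      · exact zero_mem _
    intro x
    exact this (htop ▸ Submodule.mem_top)
  · obtain ⟨f, rfl⟩ := h.surjective x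
    have : f = 0 := by
      ext i
      have key : p i ∘ₗ DirectSum.coeLinearMap U =
          (U i).subtype ∘ₗ DirectSum.component k ℕ (fun i => U i) i := by
        refine DirectSum.linearMap_ext _ fun j => LinearMap.ext fun x => ?_
        simp only [LinearMap.comp_apply, DirectSum.coeLinearMap_lof, hp i j x x.2]
        split_ifs with hij
        · subst hij
          simp [DirectSum.component.lof_self]
        · rw [DirectSum.component.of, dif_neg (fun e => hij e.symm)]
          simp
      have h1 := LinearMap.congr_fun key f
      exact h1.symm.trans (hx i)
    subst this
    simp

end Gradings

/-! ### Connected graded coalgebras and their antipode. -/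

section Connected

variable {k R : Type*} [Field k] [Ring R] [Algebra k R] [Coalgebra k R]

/-- In a connected graded coalgebra the comultiplication is `x ↦ x ⊗ 1 + 1 ⊗ x` up to terms of
positive degree in both factors. -/
theorem comul_sub_mem {𝒢 : ℕ → Submodule k R} (h0 : 𝒢 0 = Submodule.span k {1})
    (hcomul : ∀ {n : ℕ} {x : R}, x ∈ 𝒢 n → Coalgebra.comul (R := k) x ∈ tensorGrading 𝒢 𝒢 n)
    (hcounit : ∀ {n : ℕ} {x : R}, n ≠ 0 → x ∈ 𝒢 n → Coalgebra.counit (R := k) x = 0)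
    (hone : Coalgebra.counit (R := k) (1 : R) = 1)
    {n : ℕ} (hn : n ≠ 0) {x : R} (hx : x ∈ 𝒢 n) {W : Submodule k (R ⊗[k] R)}
    (hW : ∀ i j, i + j = n → i ≠ 0 → j ≠ 0 → ∀ y ∈ 𝒢 i, ∀ z ∈ 𝒢 j, y ⊗ₜ[k] z ∈ W) :
    Coalgebra.comul (R := k) x - (x ⊗ₜ 1 + 1 ⊗ₜ x) ∈ W := by
  -- By the counit axioms `f` sends `Δ x` to `Δ x - x ⊗ 1 - 1 ⊗ x`. On tensors of total degree `n ≠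
  -- 0` it kills those with a factor of degree `0` and fixes the others.
  let f : R ⊗[k] R →ₗ[k] R ⊗[k] R := LinearMap.id -
    ((TensorProduct.mk k R R).flip 1 ∘ₗ (TensorProduct.rid k R).toLinearMap ∘ₗ
        (Coalgebra.counit (R := k) (A := R)).lTensor R +
      TensorProduct.mk k R R 1 ∘ₗ (TensorProduct.lid k R).toLinearMap ∘ₗ
        (Coalgebra.counit (R := k) (A := R)).rTensor R)
  have hf : ∀ y z : R, f (y ⊗ₜ z) = y ⊗ₜ z - ((Coalgebra.counit (R := k) z • y) ⊗ₜ 1 +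
      1 ⊗ₜ (Coalgebra.counit (R := k) y • z)) := fun y z => by
    simp [f, TensorProduct.smul_tmul']
  have hfx : f (Coalgebra.comul x) = Coalgebra.comul (R := k) x - (x ⊗ₜ 1 + 1 ⊗ₜ x) := by
    simp [f]
  rw [← hfx]
  refine map_mem_of_mem_tensorGrading f (fun i j hij y hy z hz => ?_) (hcomul hx)
  rw [hf]
  rcases eq_or_ne i 0 with rfl | hi
  · rw [h0, Submodule.mem_span_singleton] at hy
    obtain ⟨c, rfl⟩ := hy
    have : Coalgebra.counit (R := k) z = 0 := hcounit (by omega) hz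
    simp [this, hone, TensorProduct.smul_tmul]
  rcases eq_or_ne j 0 with rfl | hj
  · rw [h0, Submodule.mem_span_singleton] at hz
    obtain ⟨c, rfl⟩ := hz
    have : Coalgebra.counit (R := k) y = 0 := hcounit (by omega) hy
    simp [this, hone, TensorProduct.smul_tmul]
  · simpa [hcounit hi hy, hcounit hj hz] using hW i j hij hi hj y hy z hz

/-- The antipode of a connected graded braided Hopf algebra is graded. -/
theorem antipode_mem_of_connected {A : Type*} [Ring A] [HopfAlgebra k A] [Module A R]
    [IsScalarTower k A R] [YetterDrinfeldModule k A R] [BraidedHopfAlgebra k A R]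
    {𝒢 : ℕ → Submodule k R} (h0 : 𝒢 0 = Submodule.span k {1})
    (hmul : ∀ {i j : ℕ} {x y : R}, x ∈ 𝒢 i → y ∈ 𝒢 j → x * y ∈ 𝒢 (i + j))
    (hcomul : ∀ {n : ℕ} {x : R}, x ∈ 𝒢 n → Coalgebra.comul (R := k) x ∈ tensorGrading 𝒢 𝒢 n)
    (hcounit : ∀ {n : ℕ} {x : R}, n ≠ 0 → x ∈ 𝒢 n → Coalgebra.counit (R := k) x = 0)
    {n : ℕ} {x : R} (hx : x ∈ 𝒢 n) :
    BraidedHopfAlgebra.antipode (k := k) (A := A) x ∈ 𝒢 n := by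
  have hone : Coalgebra.counit (R := k) (1 : R) = 1 := BraidedHopfAlgebra.counit_one (A := A)
  have hS1 : BraidedHopfAlgebra.antipode (k := k) (A := A) (1 : R) = 1 := by
    have := LinearMap.congr_fun (BraidedHopfAlgebra.antipode_left (k := k) (A := A) (R := R)) 1
    simpa [BraidedHopfAlgebra.comul_one (k := k) (A := A), hone] using this
  induction n using Nat.strong_induction_on generalizing x with
  | _ n ih =>
    rcases eq_or_ne n 0 with rfl | hn
    · rw [h0, Submodule.mem_span_singleton] at hx ⊢
      obtain ⟨c, rfl⟩ := hx
      exact ⟨c, by simp [hS1]⟩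
    · let f : R ⊗[k] R →ₗ[k] R := LinearMap.mul' k R ∘ₗ
        (BraidedHopfAlgebra.antipode (k := k) (A := A) (R := R)).rTensor R
      have hf : f (Coalgebra.comul x) = 0 := by
        have := LinearMap.congr_fun
          (BraidedHopfAlgebra.antipode_left (k := k) (A := A) (R := R)) x
        simpa [f, hcounit hn hx] using this
      -- Modulo `𝒢 n`, the relation `f (Δ x) = ε(x) 1 = 0` becomes `S(x) + x ≡ 0`: by induction the
      -- mixed terms `S(y) z` already lie in `𝒢 n`.
      have h := comul_sub_mem h0 hcomul hcounit hone hn hx (W := (𝒢 n).comap f)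
        (fun i j hij hi hj y hy z hz => by
          simpa [f, ← hij] using hmul (ih i (by omega) hy) hz)
      rw [Submodule.mem_comap, map_sub, hf, zero_sub, neg_mem_iff, map_add] at h
      simpa [f, hS1] using (Submodule.sub_mem _ h hx)

end Connected

/-! ### The grading of `B` by words in homogeneous elements of `M`. -/

/-- `x` is a product of `m` elements `ι v` with `v` homogeneous, and the degrees of the `v` add up
to `n`. -/
inductive IsGradedWord {k M B : Type*} [Field k] [AddCommGroup M] [Module k M] [Ring B]
    [Algebra k B] (ι : M →ₗ[k] B) (ℳ : ℕ → Submodule k M) : ℕ → ℕ → B → Prop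
  | one : IsGradedWord ι ℳ 0 0 1
  | mul {i m n : ℕ} {v : M} {x : B} (hv : v ∈ ℳ i) (hx : IsGradedWord ι ℳ m n x) :
      IsGradedWord ι ℳ (m + 1) (i + n) (ι v * x)

/-- The span of the words of degree `n` in homogeneous elements of `M`. -/
def wordGrading {k M B : Type*} [Field k] [AddCommGroup M] [Module k M] [Ring B]
    [Algebra k B] (ι : M →ₗ[k] B) (ℳ : ℕ → Submodule k M) (n : ℕ) : Submodule k B :=
  Submodule.span k {x | ∃ m, IsGradedWord ι ℳ m n x}

section Words

variable {k M B P : Type*} [Field k] [AddCommGroup M] [Module k M] [Ring B] [Algebra k B]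
  [AddCommGroup P] [Module k P] {ι : M →ₗ[k] B} {ℳ : ℕ → Submodule k M}

theorem map_mem_of_mem_wordGrading {n : ℕ} {W : Submodule k P} (f : B →ₗ[k] P)
    (h : ∀ m x, IsGradedWord ι ℳ m n x → f x ∈ W) {x : B} (hx : x ∈ wordGrading ι ℳ n) :
    f x ∈ W := by
  have : wordGrading ι ℳ n ≤ W.comap f := Submodule.span_le.2 fun x ⟨m, hx⟩ => h m x hx
  exact this hx

theorem eq_of_mem_wordGrading {n : ℕ} {f g : B →ₗ[k] P}
    (h : ∀ m x, IsGradedWord ι ℳ m n x → f x = g x) {x : B} (hx : x ∈ wordGrading ι ℳ n) :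
    f x = g x :=
  sub_eq_zero.1 <| (Submodule.mem_bot k).1 <| map_mem_of_mem_wordGrading (f - g)
    (fun m x hx => by simp [h m x hx]) hx

theorem IsGradedWord.mem {m n : ℕ} {x : B} (hx : IsGradedWord ι ℳ m n x) :
    x ∈ wordGrading ι ℳ n :=
  Submodule.subset_span ⟨m, hx⟩

theorem one_mem_wordGrading : (1 : B) ∈ wordGrading ι ℳ 0 := IsGradedWord.one.mem

theorem ι_mul_mem_wordGrading {i n : ℕ} {v : M} {x : B} (hv : v ∈ ℳ i)
    (hx : x ∈ wordGrading ι ℳ n) : ι v * x ∈ wordGrading ι ℳ (i + n) :=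
  map_mem_of_mem_wordGrading (W := wordGrading ι ℳ (i + n)) (LinearMap.mulLeft k (ι v))
    (fun _ _ hx => (hx.mul hv).mem) hx

theorem ι_mem_wordGrading {i : ℕ} {v : M} (hv : v ∈ ℳ i) : ι v ∈ wordGrading ι ℳ i := by
  simpa using (IsGradedWord.one.mul hv).mem (ι := ι)

theorem mul_mem_wordGrading {i j : ℕ} {x y : B} (hx : x ∈ wordGrading ι ℳ i)
    (hy : y ∈ wordGrading ι ℳ j) : x * y ∈ wordGrading ι ℳ (i + j) := by
  suffices h : ∀ m z, IsGradedWord ι ℳ m i z → z * y ∈ wordGrading ι ℳ (i + j) from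
    map_mem_of_mem_wordGrading (W := wordGrading ι ℳ (i + j)) (LinearMap.mulRight k y) h hx
  clear hx x
  intro m x hx
  induction hx with
  | one => simpa using hy
  | mul hv hx ih =>
    rw [mul_assoc, add_assoc]
    exact ι_mul_mem_wordGrading hv ih

theorem iSup_wordGrading_eq_top (hℳ : ⨆ i, ℳ i = ⊤)
    (hgen : Algebra.adjoin k (LinearMap.range ι : Set B) = ⊤) :
    ⨆ n, wordGrading ι ℳ n = ⊤ := by
  have key : ∀ {x y : B}, x ∈ ⨆ n, wordGrading ι ℳ n → y ∈ ⨆ n, wordGrading ι ℳ n →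
      x * y ∈ ⨆ n, wordGrading ι ℳ n := by
    intro x y hx hy
    induction hx using Submodule.iSup_induction' with
    | mem i x hx =>
      induction hy using Submodule.iSup_induction' with
      | mem j y hy => exact Submodule.mem_iSup_of_mem _ (mul_mem_wordGrading hx hy)
      | zero => simp
      | add y z _ _ h1 h2 => simpa [mul_add] using add_mem h1 h2
    | zero => simp
    | add y z _ _ h1 h2 => simpa [add_mul] using add_mem h1 h2
  refine eq_top_iff.2 fun x _ => ?_
  have hx : x ∈ Algebra.adjoin k (LinearMap.range ι : Set B) := hgen ▸ Algebra.mem_top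
  induction hx using Algebra.adjoin_induction with
  | mem x hx =>
    obtain ⟨v, rfl⟩ := hx
    have : (⨆ i, ℳ i) ≤ (⨆ n, wordGrading ι ℳ n).comap ι :=
      iSup_le fun i v hv => Submodule.mem_iSup_of_mem i (ι_mem_wordGrading hv)
    exact this (hℳ ▸ Submodule.mem_top)
  | algebraMap r =>
    rw [Algebra.algebraMap_eq_smul_one]
    exact Submodule.smul_mem _ _ (Submodule.mem_iSup_of_mem 0 one_mem_wordGrading)
  | add x y _ _ hx hy => exact add_mem (hx trivial) (hy trivial)
  | mul x y _ _ hx hy => exact key (hx trivial) (hy trivial)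

/-- A word of degree `0` is a multiple of `1` if `M` lives in positive degrees. -/
theorem wordGrading_zero (hℳ0 : ℳ 0 = ⊥) : wordGrading ι ℳ 0 = Submodule.span k {1} := by
  refine le_antisymm (Submodule.span_le.2 ?_) ?_
  · rintro x ⟨m, hx⟩
    generalize hn : (0 : ℕ) = n at hx
    cases hx with
    | one => exact Submodule.mem_span_singleton_self 1
    | @mul i m n v x hv hx =>
      obtain rfl : i = 0 := by omega
      rw [hℳ0, Submodule.mem_bot] at hv
      simp [hv]
  · rw [Submodule.span_singleton_le_iff_mem]
    exact one_mem_wordGrading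

/-- A nonzero word has letters of positive degree, so in degree `1` the first letter carries the
whole degree and the remaining factor has degree `0`, hence is a scalar. -/
theorem wordGrading_one (hℳ0 : ℳ 0 = ⊥) : wordGrading ι ℳ 1 = (ℳ 1).map ι := by
  refine le_antisymm (Submodule.span_le.2 ?_) ?_
  · rintro x ⟨m, hx⟩
    generalize hn : (1 : ℕ) = n at hx
    cases hx with
    | one => omega
    | @mul i m n v x hv hx =>
      rcases eq_or_ne i 0 with rfl | hi
      · rw [hℳ0, Submodule.mem_bot] at hv
        simpa [hv] using ⟨0, zero_mem _, map_zero ι⟩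
      · obtain rfl : n = 0 := by omega
        obtain rfl : i = 1 := by omega
        have hx' := hx.mem
        rw [wordGrading_zero hℳ0, Submodule.mem_span_singleton] at hx'
        obtain ⟨c, rfl⟩ := hx'
        exact ⟨c • v, Submodule.smul_mem _ _ hv, by simp⟩
  · rintro _ ⟨v, hv, rfl⟩
    exact ι_mem_wordGrading hv

end Words

/-! ### Compatibility of the braided structure maps with degrees. -/

section Braiding

variable {k A M B : Type*} [Field k] [Ring A] [HopfAlgebra k A] [AddCommGroup M] [Module k M]
  [Ring B] [Algebra k B] [Module A B] [IsScalarTower k A B] [YetterDrinfeldModule k A B]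
  {𝒜 : ℕ → Submodule k A} {ℳ : ℕ → Submodule k M} {ι : M →ₗ[k] B}

theorem lTensor_mul_tensorCoact_mem (h𝒜 : IsHopfGrading 𝒜) {i j : ℕ} {x y : B}
    (hx : coact (k := k) (A := A) x ∈ tensorGrading 𝒜 (wordGrading ι ℳ) i)
    (hy : coact (k := k) (A := A) y ∈ tensorGrading 𝒜 (wordGrading ι ℳ) j) :
    (LinearMap.mul' k B).lTensor A (tensorCoact k A B B (x ⊗ₜ y)) ∈
      tensorGrading 𝒜 (wordGrading ι ℳ) (i + j) := by
  let f : (A ⊗[k] B) →ₗ[k] (A ⊗[k] B) →ₗ[k] A ⊗[k] B :=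
    TensorProduct.curry ((LinearMap.mul' k B).lTensor A ∘ₗ
      (LinearMap.mul' k A).rTensor (B ⊗[k] B) ∘ₗ
      (TensorProduct.tensorTensorTensorComm k A B A B).toLinearMap)
  have hf : (LinearMap.mul' k B).lTensor A (tensorCoact k A B B (x ⊗ₜ y)) =
      f (coact x) (coact y) := rfl
  rw [hf]
  refine map_mem_of_mem_tensorGrading (f.flip (coact y)) (fun p q hpq a ha z hz => ?_) hx
  refine map_mem_of_mem_tensorGrading (f (a ⊗ₜ z)) (fun r s hrs b hb w hw => ?_) hy
  exact tmul_mem_tensorGrading (by omega) (h𝒜.mul_mem ha hb) (mul_mem_wordGrading hz hw)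

theorem braiding_mem {ℬ : ℕ → Submodule k B}
    (hsmul : ∀ {i j : ℕ} {a : A} {x : B}, a ∈ 𝒜 i → x ∈ ℬ j → a • x ∈ ℬ (i + j))
    (hcoact : ∀ {n : ℕ} {x : B}, x ∈ ℬ n → coact (k := k) (A := A) x ∈ tensorGrading 𝒜 ℬ n)
    {i j : ℕ} {x y : B} (hx : x ∈ ℬ i) (hy : y ∈ ℬ j) :
    braiding k A B B (x ⊗ₜ y) ∈ tensorGrading ℬ ℬ (i + j) := by
  let f : (A ⊗[k] B) →ₗ[k] B →ₗ[k] B ⊗[k] B :=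
    TensorProduct.curry ((act k A B).rTensor B ∘ₗ (TensorProduct.rightComm k A B B).toLinearMap)
  have hf : braiding k A B B (x ⊗ₜ y) = f.flip y (coact x) := rfl
  rw [hf]
  refine map_mem_of_mem_tensorGrading (f.flip y) (fun p q hpq a ha z hz => ?_) (hcoact hx)
  exact tmul_mem_tensorGrading (by omega) (hsmul ha hy) hz

theorem braidedMul_mem {ℬ : ℕ → Submodule k B}
    (hmul : ∀ {i j : ℕ} {x y : B}, x ∈ ℬ i → y ∈ ℬ j → x * y ∈ ℬ (i + j))
    (hsmul : ∀ {i j : ℕ} {a : A} {x : B}, a ∈ 𝒜 i → x ∈ ℬ j → a • x ∈ ℬ (i + j))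
    (hcoact : ∀ {n : ℕ} {x : B}, x ∈ ℬ n → coact (k := k) (A := A) x ∈ tensorGrading 𝒜 ℬ n)
    {i j : ℕ} {s t : B ⊗[k] B} (hs : s ∈ tensorGrading ℬ ℬ i) (ht : t ∈ tensorGrading ℬ ℬ j) :
    braidedMul k A B (s ⊗ₜ t) ∈ tensorGrading ℬ ℬ (i + j) := by
  let f := TensorProduct.curry (braidedMul k A B)
  change f s t ∈ _
  refine map_mem_of_mem_tensorGrading (f.flip t) (fun p q hpq a ha b hb => ?_) hs
  refine map_mem_of_mem_tensorGrading (f (a ⊗ₜ b)) (fun r u hru c hc d hd => ?_) ht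
  -- With the outer factors `a`, `d` fixed, the braided product sends `z ⊗ w`, a term of the
  -- braiding of `b ⊗ c`, to `a z ⊗ w d`.
  let g : B ⊗[k] B →ₗ[k] B ⊗[k] B :=
    TensorProduct.map (LinearMap.mul' k B) (LinearMap.mul' k B) ∘ₗ
    (TensorProduct.assoc k B B (B ⊗[k] B)).symm.toLinearMap ∘ₗ
    TensorProduct.mk k B (B ⊗[k] (B ⊗[k] B)) a ∘ₗ
    (TensorProduct.assoc k B B B).toLinearMap ∘ₗ (TensorProduct.mk k (B ⊗[k] B) B).flip d
  have hg : f (a ⊗ₜ b) (c ⊗ₜ d) = g (braiding k A B B (b ⊗ₜ c)) := rfl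
  rw [hg]
  refine map_mem_of_mem_tensorGrading g (fun p' q' hpq' z hz w hw => ?_)
    (braiding_mem hsmul hcoact hb hc)
  exact tmul_mem_tensorGrading (by omega) (hmul ha hz) (hmul hw hd)

end Braiding

/-! ### Action, coaction and comultiplication respect the word grading. -/

section Hopf

variable {k A M B : Type*} [Field k] [Ring A] [HopfAlgebra k A]
  [AddCommGroup M] [Module k M] [Module A M] [IsScalarTower k A M] [YetterDrinfeldModule k A M]
  [Ring B] [Algebra k B] [Coalgebra k B] [Module A B] [IsScalarTower k A B]
  [YetterDrinfeldModule k A B] [BraidedHopfAlgebra k A B]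
  {𝒜 : ℕ → Submodule k A} {ℳ : ℕ → Submodule k M} {ι : M →ₗ[k] B}

theorem smul_mem_wordGrading (h𝒜 : IsHopfGrading 𝒜) (hℳ : IsYDGrading 𝒜 ℳ)
    (hι : ∀ (a : A) (m : M), ι (a • m) = a • ι m)
    {i n : ℕ} {a : A} {x : B} (ha : a ∈ 𝒜 i) (hx : x ∈ wordGrading ι ℳ n) :
    a • x ∈ wordGrading ι ℳ (i + n) := by
  suffices h : ∀ m y, IsGradedWord ι ℳ m n y → a • y ∈ wordGrading ι ℳ (i + n) from
    map_mem_of_mem_wordGrading (Algebra.lsmul k k B a) h hx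
  clear hx x
  intro m x hx
  induction hx generalizing a i with
  | one =>
    -- Here `a • 1 = ε(a) 1` has degree `0`, which is consistent because `ε` vanishes on `𝒜 i` for
    -- `i ≠ 0`.
    rw [BraidedHopfAlgebra.smul_one (k := k)]
    rcases eq_or_ne i 0 with rfl | hi
    · rw [Algebra.algebraMap_eq_smul_one]
      exact Submodule.smul_mem _ _ one_mem_wordGrading
    · simp [h𝒜.counit_eq_zero hi ha]
  | @mul j m n v x hv hx ih =>
    rw [BraidedHopfAlgebra.smul_mul (k := k)]
    let f : A ⊗[k] A →ₗ[k] B := LinearMap.mul' k B ∘ₗ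
      TensorProduct.map ((Algebra.lsmul k k B : A →ₐ[k] Module.End k B).toLinearMap.flip (ι v))
        ((Algebra.lsmul k k B : A →ₐ[k] Module.End k B).toLinearMap.flip x)
    have hf : LinearMap.mul' k B (tensorAct k A B B a (ι v ⊗ₜ x)) = f (Coalgebra.comul a) := by
      simp only [tensorAct, f, LinearMap.comp_apply]
      congr 1
      generalize (Coalgebra.comul (R := k) a : A ⊗[k] A) = t
      induction t with
      | zero => simp
      | tmul b c => rfl
      | add s t hs ht => simp only [map_add, LinearMap.add_apply, hs, ht]
    rw [hf]
    refine map_mem_of_mem_tensorGrading f (fun p q hpq b hb c hc => ?_) (h𝒜.comul_mem ha)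
    have := ι_mul_mem_wordGrading (hℳ.smul_mem hb hv) (ih hc)
    rw [hι, show p + j + (q + n) = i + (j + n) by omega] at this
    exact this

theorem coact_mem_wordGrading (h𝒜 : IsHopfGrading 𝒜) (hℳ : IsYDGrading 𝒜 ℳ)
    (hι : ∀ m : M, coact (k := k) (A := A) (ι m) = ι.lTensor A (coact m))
    {n : ℕ} {x : B} (hx : x ∈ wordGrading ι ℳ n) :
    coact (k := k) (A := A) x ∈ tensorGrading 𝒜 (wordGrading ι ℳ) n := by
  suffices h : ∀ m y, IsGradedWord ι ℳ m n y →
      coact (k := k) (A := A) y ∈ tensorGrading 𝒜 (wordGrading ι ℳ) n from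
    map_mem_of_mem_wordGrading (W := tensorGrading 𝒜 (wordGrading ι ℳ) n) coact h hx
  clear hx x
  intro m x hx
  induction hx with
  | one =>
    rw [BraidedHopfAlgebra.coact_one]
    exact tmul_mem_tensorGrading (add_zero 0) h𝒜.one_mem one_mem_wordGrading
  | @mul j m n v x hv hx ih =>
    rw [BraidedHopfAlgebra.coact_mul]
    refine lTensor_mul_tensorCoact_mem h𝒜 ?_ ih
    rw [hι]
    exact map_mem_of_mem_tensorGrading (W := tensorGrading 𝒜 (wordGrading ι ℳ) j)
      (ι.lTensor A) (fun p q hpq a ha w hw =>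
      tmul_mem_tensorGrading hpq ha (ι_mem_wordGrading hw)) (hℳ.coact_mem hv)

theorem comul_mem_wordGrading (h𝒜 : IsHopfGrading 𝒜) (hℳ : IsYDGrading 𝒜 ℳ)
    (hsmul : ∀ (a : A) (m : M), ι (a • m) = a • ι m)
    (hcoact : ∀ m : M, coact (k := k) (A := A) (ι m) = ι.lTensor A (coact m))
    (hprim : ∀ m : M, Coalgebra.comul (R := k) (ι m) = ι m ⊗ₜ 1 + 1 ⊗ₜ ι m)
    {n : ℕ} {x : B} (hx : x ∈ wordGrading ι ℳ n) :
    Coalgebra.comul (R := k) x ∈ tensorGrading (wordGrading ι ℳ) (wordGrading ι ℳ) n := by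
  suffices h : ∀ m y, IsGradedWord ι ℳ m n y → Coalgebra.comul (R := k) y ∈
      tensorGrading (wordGrading ι ℳ) (wordGrading ι ℳ) n from
    map_mem_of_mem_wordGrading
      (W := tensorGrading (wordGrading ι ℳ) (wordGrading ι ℳ) n) Coalgebra.comul h hx
  clear hx x
  intro m x hx
  induction hx with
  | one =>
    rw [BraidedHopfAlgebra.comul_one (A := A)]
    exact tmul_mem_tensorGrading (add_zero 0) one_mem_wordGrading one_mem_wordGrading
  | @mul j m n v x hv hx ih =>
    rw [BraidedHopfAlgebra.comul_mul (A := A)]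
    refine braidedMul_mem (𝒜 := 𝒜) (ℬ := wordGrading ι ℳ) mul_mem_wordGrading (smul_mem_wordGrading h𝒜 hℳ hsmul)
      (coact_mem_wordGrading h𝒜 hℳ hcoact) ?_ ih
    rw [hprim]
    exact add_mem
      (tmul_mem_tensorGrading (add_zero _) (ι_mem_wordGrading hv) one_mem_wordGrading)
      (tmul_mem_tensorGrading (zero_add _) one_mem_wordGrading (ι_mem_wordGrading hv))

end Hopf

/-! ### Separating degrees one length at a time. -/

section Independence

variable {k M B : Type*} [Field k] [AddCommGroup M] [Module k M] [Ring B] [Algebra k B]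
  {ι : M →ₗ[k] B} {ℳ : ℕ → Submodule k M} {ℛ : ℕ → Submodule k B}

theorem IsGradedWord.mem_of_range_le (hone : (1 : B) ∈ ℛ 0)
    (hmul : ∀ {i j : ℕ} {x y : B}, x ∈ ℛ i → y ∈ ℛ j → x * y ∈ ℛ (i + j))
    (hι : ∀ v, ι v ∈ ℛ 1) {m n : ℕ} {x : B} (hx : IsGradedWord ι ℳ m n x) : x ∈ ℛ m := by
  induction hx with
  | one => exact hone
  | mul hv hx ih => exact add_comm 1 _ ▸ hmul (hι _) ih

/-- If the images of the spaces `wordGrading ι ℳ n` under each `π m` are independent, then so are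
these spaces. -/
theorem iSupIndep_wordGrading_of_separation {π : ℕ → B →ₗ[k] B}
    (hzero : ∀ x, (∀ i, π i x = 0) → x = 0)
    (h : ∀ m, ∃ p : ℕ → B →ₗ[k] B, ∀ a b, ∀ x ∈ wordGrading ι ℳ b,
      p a x = if a = b then π m x else 0) : iSupIndep (wordGrading ι ℳ) := by
  choose p hp using h
  -- The family `(p m n)` over all `m` is a single map to a product. It kills degrees other than
  -- `n`, and on degree `n` it equals `(π m)`, which is jointly injective.
  refine iSupIndep_of_forall_exists_projection fun n x hx =>
    ⟨LinearMap.pi fun m => p m n, fun n' hn' y hy => ?_, fun h0 => hzero x fun m => ?_⟩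
  · ext m
    simp [hp m n n' y hy, hn'.symm]
  · have := congrFun h0 m
    simpa [hp m n n x hx] using this

variable {π : ℕ → B →ₗ[k] B} (hword : ∀ {m n : ℕ} {x : B}, IsGradedWord ι ℳ m n x → x ∈ ℛ m)
  (hπ : ∀ i j, ∀ x ∈ ℛ j, π i x = if i = j then x else 0)

include hword hπ

/-- The two gradings are compatible: `π m` either fixes or kills each word, according to its length.
-/
theorem projection_mem_wordGrading {m n : ℕ} {x : B} (hx : x ∈ wordGrading ι ℳ n) :
    π m x ∈ wordGrading ι ℳ n :=
  map_mem_of_mem_wordGrading (π m) (fun l y hy => by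
    rw [hπ m l y (hword hy)]
    split_ifs
    exacts [hy.mem, zero_mem _]) hx

/-- Only the empty word survives `π 0`, and its degree is `0`. -/
theorem exists_separation_zero :
    ∃ p : ℕ → B →ₗ[k] B, ∀ a b, ∀ x ∈ wordGrading ι ℳ b,
      p a x = if a = b then π 0 x else 0 := by
  refine ⟨fun a => if a = 0 then π 0 else 0, fun a b x hx => ?_⟩
  refine eq_of_mem_wordGrading (f := if a = 0 then π 0 else 0)
    (g := if a = b then π 0 else 0) (fun m y hy => ?_) hx |>.trans (by split_ifs <;> rfl)
  cases hy with
  | one => rfl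
  | mul hv hy =>
    have : π 0 (ι _ * _) = 0 := (hπ 0 _ _ (hword (hy.mul hv))).trans (if_neg (by omega))
    split_ifs <;> simp [this]

/-- Only words `ι v` with a single letter survive `π 1`. As `ι` is injective, their degree can be
read off in `M`. -/
theorem exists_separation_one (hℳ : iSupIndep ℳ) (hι : Function.Injective ι) :
    ∃ p : ℕ → B →ₗ[k] B, ∀ a b, ∀ x ∈ wordGrading ι ℳ b,
      p a x = if a = b then π 1 x else 0 := by
  obtain ⟨q, hq⟩ := exists_projection_of_iSupIndep hℳ
  obtain ⟨g, hg⟩ := LinearMap.exists_leftInverse_of_injective ι (LinearMap.ker_eq_bot.2 hι)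
  refine ⟨fun a => ι ∘ₗ q a ∘ₗ g ∘ₗ π 1, fun a b x hx => ?_⟩
  refine eq_of_mem_wordGrading (f := ι ∘ₗ q a ∘ₗ g ∘ₗ π 1)
    (g := if a = b then π 1 else 0) (fun m y hy => ?_) hx |>.trans (by split_ifs <;> rfl)
  have h1 := hπ 1 m y (hword hy)
  by_cases hm : 1 = m
  · cases hy with
    | one => omega
    | @mul i m n v y hv hy =>
      cases hy with
      | mul hv hy => omega
      | one =>
        rw [if_pos hm, mul_one] at h1
        have hgv : g (ι v) = v := LinearMap.congr_fun hg v
        simp only [LinearMap.comp_apply, mul_one, h1, hgv, hq a i v hv, add_zero]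
        split_ifs <;> simp [h1]
  · rw [if_neg hm] at h1
    split_ifs <;> simp [h1]

/-- A grading of the algebra `B` for which `B` is generated by the image of `ι`, in degree one, is
connected. -/
theorem eq_span_one_of_generated (hone : (1 : B) ∈ ℛ 0) (hℳ : ⨆ i, ℳ i = ⊤)
    (hgen : Algebra.adjoin k (LinearMap.range ι : Set B) = ⊤) :
    ℛ 0 = Submodule.span k {1} := by
  refine le_antisymm (fun x hx => ?_) ((Submodule.span_singleton_le_iff_mem _ _).2 hone)
  have h : (⨆ n, wordGrading ι ℳ n) ≤ (Submodule.span k {1}).comap (π 0) :=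
    iSup_le fun n y hy => map_mem_of_mem_wordGrading (W := Submodule.span k {1}) (π 0)
      (fun m z hz => by
        rw [hπ 0 m z (hword hz)]
        cases hz with
        | one => exact Submodule.mem_span_singleton_self 1
        | mul hv hz => simp) hy
  have hx' := h (iSup_wordGrading_eq_top hℳ hgen ▸ Submodule.mem_top (x := x))
  rwa [Submodule.mem_comap, hπ 0 0 x hx, if_pos rfl] at hx'

end Independence

/-! ### The inductive step: detecting degree through the comultiplication. -/

section Primitive

variable {k M B : Type*} [Field k] [AddCommGroup M] [Module k M] [Ring B] [Algebra k B]
  [Coalgebra k B] {ι : M →ₗ[k] B} {ℳ : ℕ → Submodule k M} {ℛ : ℕ → Submodule k B}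
  {π : ℕ → B →ₗ[k] B}

/-- The map `x ↦ T n (Δ x)` isolates degree `n` in length `m`. It uses only the separations for
lengths below `m`, and it is injective on the degree `n` part because its kernel there is primitive
and has length `m ≠ 1`. -/
theorem exists_separation_succ_succ
    (hword : ∀ {m n : ℕ} {x : B}, IsGradedWord ι ℳ m n x → x ∈ ℛ m)
    (hπ : ∀ i j, ∀ x ∈ ℛ j, π i x = if i = j then x else 0) (hπmem : ∀ i x, π i x ∈ ℛ i)
    (h0 : ℛ 0 = Submodule.span k {1})
    (hcomul : ∀ {n : ℕ} {x : B}, x ∈ ℛ n → Coalgebra.comul (R := k) x ∈ tensorGrading ℛ ℛ n)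
    (hcounit : ∀ {n : ℕ} {x : B}, n ≠ 0 → x ∈ ℛ n → Coalgebra.counit (R := k) x = 0)
    (hone : Coalgebra.counit (R := k) (1 : B) = 1)
    (hprim : ∀ x : B, Coalgebra.comul (R := k) x = x ⊗ₜ 1 + 1 ⊗ₜ x → x ∈ ℛ 1)
    (hcomul' : ∀ {n : ℕ} {x : B}, x ∈ wordGrading ι ℳ n →
      Coalgebra.comul (R := k) x ∈ tensorGrading (wordGrading ι ℳ) (wordGrading ι ℳ) n)
    {m : ℕ} (hm : 2 ≤ m)
    (ih : ∀ l < m, ∃ p : ℕ → B →ₗ[k] B, ∀ a b, ∀ x ∈ wordGrading ι ℳ b,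
      p a x = if a = b then π l x else 0) :
    ∃ p : ℕ → B →ₗ[k] B, ∀ a b, ∀ x ∈ wordGrading ι ℳ b,
      p a x = if a = b then π m x else 0 := by
  suffices hind : iSupIndep fun n => (wordGrading ι ℳ n).map (π m) by
    obtain ⟨p, hp⟩ := exists_projection_of_iSupIndep hind
    exact ⟨fun a => p a ∘ₗ π m, fun a b x hx => hp a b _ ⟨x, hx, rfl⟩⟩
  choose! p hp using ih
  let S : Finset (ℕ × ℕ) := (Finset.HasAntidiagonal.antidiagonal m).filter fun q => q.1 ≠ 0 ∧ q.2 ≠ 0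
  have hS : ∀ q ∈ S, q.1 < m ∧ q.2 < m ∧ q.1 + q.2 = m ∧ q.1 ≠ 0 ∧ q.2 ≠ 0 := by
    intro q hq
    simp only [S, Finset.mem_filter, Finset.HasAntidiagonal.mem_antidiagonal] at hq
    omega
  -- the part of the comultiplication with both factors of positive length
  let Q : B ⊗[k] B →ₗ[k] B ⊗[k] B := ∑ q ∈ S, TensorProduct.map (π q.1) (π q.2)
  -- `T n` is `Q` followed by extraction of total degree `n`: on a tensor of bidegree `(i, j)` only
  -- the term `r = (i, j)` is nonzero, and it occurs exactly when `i + j = n`.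
  let T (n : ℕ) : B ⊗[k] B →ₗ[k] B ⊗[k] B := ∑ q ∈ S, ∑ r ∈ Finset.HasAntidiagonal.antidiagonal n,
    TensorProduct.map (p q.1 r.1) (p q.2 r.2)
  have hT : ∀ n n' t, t ∈ tensorGrading (wordGrading ι ℳ) (wordGrading ι ℳ) n' →
      T n t = if n = n' then Q t else 0 := by
    intro n n' t ht
    have : (T n - if n = n' then Q else 0) t ∈ (⊥ : Submodule k (B ⊗[k] B)) := by
      refine map_mem_of_mem_tensorGrading _ (fun i j hij x hx y hy => ?_) ht
      have hTxy : T n (x ⊗ₜ y) = if n = n' then Q (x ⊗ₜ y) else 0 := by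
        have hq : ∀ q ∈ S, ∑ r ∈ Finset.HasAntidiagonal.antidiagonal n,
            p q.1 r.1 x ⊗ₜ[k] p q.2 r.2 y =
              if n = n' then π q.1 x ⊗ₜ[k] π q.2 y else 0 := by
          intro q hq
          obtain ⟨h1, h2, -⟩ := hS q hq
          rw [Finset.sum_congr rfl (g := fun r => if r = (i, j) then
            π q.1 x ⊗ₜ[k] π q.2 y else 0), Finset.sum_ite_eq']
          · simp only [Finset.HasAntidiagonal.mem_antidiagonal, hij, eq_comm]
          · intro r _
            rw [hp _ h1 _ _ _ hx, hp _ h2 _ _ _ hy]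
            by_cases hi : r.1 = i <;> by_cases hj : r.2 = j <;> simp [hi, hj, Prod.ext_iff]
        simp only [T, Q, LinearMap.sum_apply, TensorProduct.map_tmul]
        rw [Finset.sum_congr rfl hq]
        split_ifs <;> simp
      rw [Submodule.mem_bot, LinearMap.sub_apply, hTxy]
      split_ifs <;> simp
    rw [Submodule.mem_bot, LinearMap.sub_apply, sub_eq_zero] at this
    rw [this]
    split_ifs <;> rfl
  -- `Q` fixes the tensors of lengths `(i, j)` with `i + j = m` and both positive, and kills `x ⊗ 1`
  -- and `1 ⊗ x`, since `1` has length `0`.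
  have hQ : ∀ x ∈ ℛ m, Coalgebra.comul (R := k) x - (x ⊗ₜ 1 + 1 ⊗ₜ x) =
      Q (Coalgebra.comul (R := k) x) := by
    intro x hx
    have h := comul_sub_mem h0 hcomul hcounit hone (by omega) hx
      (W := LinearMap.eqLocus Q LinearMap.id) fun i j hij hi hj y hy z hz => by
        simp only [LinearMap.mem_eqLocus, Q, LinearMap.sum_apply, TensorProduct.map_tmul,
          LinearMap.id_apply]
        have hmem : (i, j) ∈ S := by simp [S, hij, hi, hj]
        rw [Finset.sum_eq_single_of_mem (i, j) hmem]
        · rw [hπ _ _ _ hy, hπ _ _ _ hz, if_pos rfl, if_pos rfl]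
        · intro q hq hne
          rw [hπ _ _ _ hy, if_neg, TensorProduct.zero_tmul]
          intro h
          exact hne (Prod.ext h (by have := (hS q hq).2.2.1; dsimp only; omega))
    have hone_mem : (1 : B) ∈ ℛ 0 := h0 ▸ Submodule.mem_span_singleton_self 1
    have h1 : Q (x ⊗ₜ 1 + 1 ⊗ₜ x) = 0 := by
      rw [map_add, LinearMap.sum_apply, LinearMap.sum_apply, ← Finset.sum_add_distrib]
      refine Finset.sum_eq_zero fun q hq => ?_
      obtain ⟨-, -, -, hq1, hq2⟩ := hS q hq
      simp [hπ _ _ _ hone_mem, hq1, hq2]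
    rw [LinearMap.mem_eqLocus, map_sub, h1, sub_zero] at h
    exact h.symm
  refine iSupIndep_of_forall_exists_projection fun n x hx =>
    ⟨T n ∘ₗ Coalgebra.comul, fun n' hn' y hy => ?_, fun hzero => ?_⟩
  · obtain ⟨y, hy, rfl⟩ := hy
    rw [LinearMap.comp_apply, hT n n' _ (hcomul' (projection_mem_wordGrading hword hπ hy)),
      if_neg hn'.symm]
  · obtain ⟨x, hx, rfl⟩ := hx
    rw [LinearMap.comp_apply, hT n n _ (hcomul' (projection_mem_wordGrading hword hπ hx)),
      if_pos rfl, ← hQ _ (hπmem m x), sub_eq_zero] at hzero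
    -- Now `π m x` is primitive, so it lies in both `ℛ 1` and `ℛ m`. As `m ≥ 2`, it vanishes.
    have h1 := hπ m 1 _ (hprim _ hzero)
    rwa [if_neg (by omega), hπ m m _ (hπmem m x), if_pos rfl] at h1

end Primitive

/-! ### Nichols algebras: directness of the word grading and the theorem. -/

section Main

variable {k A M B : Type*} [Field k] [Ring A] [HopfAlgebra k A]
  [AddCommGroup M] [Module k M] [Module A M] [IsScalarTower k A M] [YetterDrinfeldModule k A M]
  [Ring B] [Algebra k B] [Coalgebra k B] [Module A B] [IsScalarTower k A B]
  [YetterDrinfeldModule k A B] [BraidedHopfAlgebra k A B]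
  {𝒜 : ℕ → Submodule k A} {ℳ : ℕ → Submodule k M} {ι : M →ₗ[k] B}

theorem IsNicholsAlgebra.comul_ι (hι : IsNicholsAlgebra A ι) (v : M) :
    Coalgebra.comul (R := k) (ι v) = ι v ⊗ₜ 1 + 1 ⊗ₜ ι v := by
  obtain ⟨ℛ, -, -, hR1, -, hprim⟩ := hι.exists_grading
  exact (hprim _).1 (hR1 ▸ ⟨v, rfl⟩)

theorem IsNicholsAlgebra.adjoin_range (hι : IsNicholsAlgebra A ι) :
    Algebra.adjoin k (LinearMap.range ι : Set B) = ⊤ := by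
  obtain ⟨ℛ, -, -, hR1, hgen, -⟩ := hι.exists_grading
  rwa [hR1]

theorem IsNicholsAlgebra.counit_ι (hι : IsNicholsAlgebra A ι) (v : M) :
    Coalgebra.counit (R := k) (ι v) = 0 := by
  obtain ⟨ℛ, hℛ, -, hR1, -, -⟩ := hι.exists_grading
  exact hℛ.counit_eq_zero one_ne_zero (hR1 ▸ ⟨v, rfl⟩)

theorem IsNicholsAlgebra.counit_wordGrading (hι : IsNicholsAlgebra A ι) {n : ℕ} (hn : n ≠ 0)
    {x : B} (hx : x ∈ wordGrading ι ℳ n) : Coalgebra.counit (R := k) x = 0 := by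
  refine eq_of_mem_wordGrading (f := Coalgebra.counit) (g := 0) (fun m y hy => ?_) hx
  cases hy with
  | one => exact absurd rfl hn
  | mul hv hy => simp [BraidedHopfAlgebra.counit_mul (k := k) (A := A), hι.counit_ι]

theorem IsNicholsAlgebra.comul_mem_wordGrading (hι : IsNicholsAlgebra A ι)
    (h𝒜 : IsHopfGrading 𝒜) (hℳ : IsYDGrading 𝒜 ℳ) {n : ℕ} {x : B}
    (hx : x ∈ wordGrading ι ℳ n) :
    Coalgebra.comul (R := k) x ∈ tensorGrading (wordGrading ι ℳ) (wordGrading ι ℳ) n :=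
  Nichols.comul_mem_wordGrading h𝒜 hℳ hι.ι_smul hι.ι_coact hι.comul_ι hx

theorem IsNicholsAlgebra.isInternal_wordGrading (hι : IsNicholsAlgebra A ι)
    (h𝒜 : IsHopfGrading 𝒜) (hℳ : IsYDGrading 𝒜 ℳ) :
    DirectSum.IsInternal (wordGrading ι ℳ) := by
  have htop := hℳ.isInternal.submodule_iSup_eq_top
  refine DirectSum.isInternal_submodule_of_iSupIndep_of_iSup_eq_top ?_
    (iSup_wordGrading_eq_top htop hι.adjoin_range)
  obtain ⟨ℛ, hℛ, -, hR1, -, hprim⟩ := hι.exists_grading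
  obtain ⟨π, hπ, hπmem, hzero⟩ := exists_projection_of_isInternal hℛ.isInternal
  have hword : ∀ {m n : ℕ} {x : B}, IsGradedWord ι ℳ m n x → x ∈ ℛ m := fun hx =>
    hx.mem_of_range_le hℛ.one_mem hℛ.mul_mem fun v => hR1 ▸ ⟨v, rfl⟩
  -- Strong induction on the length is needed: a word of length `m` comultiplies into pieces of
  -- every smaller length.
  refine iSupIndep_wordGrading_of_separation hzero fun m => ?_
  induction m using Nat.strong_induction_on with
  | _ m ih =>
    match m with
    | 0 => exact exists_separation_zero hword hπ
    | 1 => exact exists_separation_one hword hπ hℳ.isInternal.submodule_iSupIndep hι.ι_injective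
    | m + 2 =>
      exact exists_separation_succ_succ hword hπ hπmem
        (eq_span_one_of_generated hword hπ hℛ.one_mem htop hι.adjoin_range) hℛ.comul_mem
        hℛ.counit_eq_zero (BraidedHopfAlgebra.counit_one (A := A)) (fun x => (hprim x).2)
        (hι.comul_mem_wordGrading h𝒜 hℳ) (by omega) ih

end Main

end

end Nichols

theorem mainTheorem7 {k A M B : Type*} [Field k]
    [Ring A] [HopfAlgebra k A]
    (hS : Function.Bijective (HopfAlgebra.antipode k : A →ₗ[k] A))
    (𝒜 : ℕ → Submodule k A) (h𝒜 : Nichols.IsHopfGrading 𝒜)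
    [AddCommGroup M] [Module k M] [Module A M] [IsScalarTower k A M]
    [Nichols.YetterDrinfeldModule k A M]
    (ℳ : ℕ → Submodule k M) (hℳ : Nichols.IsYDGrading 𝒜 ℳ) (hℳ0 : ℳ 0 = ⊥)
    [Ring B] [Algebra k B] [Coalgebra k B] [Module A B] [IsScalarTower k A B]
    [Nichols.YetterDrinfeldModule k A B] [Nichols.BraidedHopfAlgebra k A B]
    (ι : M →ₗ[k] B) (hι : Nichols.IsNicholsAlgebra A ι) :
    ∃ ℬ : ℕ → Submodule k B,
      Nichols.IsYDGrading 𝒜 ℬ ∧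
      Nichols.IsBraidedHopfGrading A ℬ ∧
      ℬ 0 = Submodule.span k {1} ∧
      ℬ 1 = (ℳ 1).map ι := by
  have hzero := Nichols.wordGrading_zero (ι := ι) hℳ0
  refine ⟨Nichols.wordGrading ι ℳ,
    { isInternal := hι.isInternal_wordGrading h𝒜 hℳ
      smul_mem := Nichols.smul_mem_wordGrading h𝒜 hℳ hι.ι_smul
      coact_mem := Nichols.coact_mem_wordGrading h𝒜 hℳ hι.ι_coact },
    { isInternal := hι.isInternal_wordGrading h𝒜 hℳ
      one_mem := Nichols.one_mem_wordGrading
      mul_mem := Nichols.mul_mem_wordGrading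
      comul_mem := hι.comul_mem_wordGrading h𝒜 hℳ
      counit_eq_zero := fun hn hx => hι.counit_wordGrading hn hx
      antipode_mem := Nichols.antipode_mem_of_connected hzero Nichols.mul_mem_wordGrading
        (hι.comul_mem_wordGrading h𝒜 hℳ) (fun hn hx => hι.counit_wordGrading hn hx) },
    hzero, Nichols.wordGrading_one hℳ0⟩
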